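/- Let $(\mathcal M,d)$ be a complete uniquely geodesic metric space: any two points $p,q$ are joined by exactly one geodesic $\gamma_p^q:[0,d(p,q)]\to\mathcal M$, meaning a map with $\gamma_p^q(0)=p$, $\gamma_p^q(d(p,q))=q$ and $d(\gamma_p^q(s),\gamma_p^q(t))=|s-t|$. For $q,r\ne p$ let $$\bar\angle_p(q,r)=\arccos\frac{d(p,q)^2+d(p,r)^2-d(q,r)^2}{2d(p,q)d(p,r)},\qquad \angle_p(q,r)=\lim_{\rho\downarrow0}\ \sup_{0<s,t<\rho}\bar\angle_p\big(\gamma_p^q(t),\gamma_p^r(s)\big)$$ be the comparison angle and the Alexandrov angle. Suppose that, for constants $C_U>0$ and $\alpha_U\in(0,1]$, $$|d(p,q)\cos\angle_p(u,q)-d(p,r)\cos\angle_p(u,r)|\le C_U\,d(q,r)^{\alpha_U}\qquad\text{for all } p,q,r,u\in\mathcal M,\ u\ne p,$$ where a product with a factor $d(p,p)=0$ is read as $0$. Let $X$ be an $\mathcal M$-valued random element with law $P$, let $\mu^*$ be a Fréchet mean of $X$ (a minimizer of $p\mapsto\mathbb E[d^2(p,X)]$), and suppose that $0<\sigma_X^2:=\mathbb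 E[d^2(\mu^*,X)]<\infty$. For $\beta\in\mathcal M$, the binary regression model with parameter $\beta$ is the law of $(X,Y)\in\mathcal M\times\{0,1\}$ for which $X$ has law $P$ and $$\log\frac{\mathbb P(Y=1\mid X)}{1-\mathbb P(Y=1\mid X)}=d(\mu^*,X)\,d(\mu^*,\beta)\cos\angle_{\mu^*}(X,\beta)$$ (the right-hand side is $0$ if $X=\mu^*$ or $\beta=\mu^*$). Let $\mathbb E_\beta$ be the expectation when $(X_1,Y_1),\dots,(X_n,Y_n)$ are i.i.d. from this law, and let $$R_n=\inf_{\hat\beta_n}\ \sup_{\beta\in\mathcal M}\mathbb E_\beta\big[d^2(\beta,\hat\beta_n)\big],$$ the infimum being over all estimators, that is, all measurable functions of the data with values in $\mathcal M$. Let $N(\epsilon,\mathcal M,d)$ be the smallest number of closed balls of radius $\epsilon$ that cover $\mathcal M$, and let $D>0$ and $c_1,c_2>0$. (a) If $c_1(1/\epsilon)^D\le N(\epsilon,\mathcal M,d)\le c_2(1/\epsilon)^D$ for all sufficiently small $\epsilon>0$, then $$R_n\ \ge\ c\left(\frac{D}{\sigma_X^2\,n}\right)^{1/\alpha_U}\qquad\text{for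 all sufficiently large } n,$$ where $c>0$ depends only on $C_U,\alpha_U,c_1,c_2$. (b) If $c_1(1/\epsilon)^D\le \log N(\epsilon,\mathcal M,d)\le c_2(1/\epsilon)^D$ (with $N(\epsilon,\mathcal M,d)<\infty$) for all sufficiently small $\epsilon>0$, then $$R_n\ \ge\ c\left(\frac{1}{\sigma_X^2\,n}\right)^{1/(\alpha_U+D/2)}\qquad\text{for all sufficiently large } n,$$ where $c>0$ depends only on $C_U,\alpha_U,c_1,c_2,D$. -/

import Mathlib

open MeasureTheory Filter Topology
open scoped ENNReal NNReal

namespace MetricRegression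

noncomputable section

/-! ### Geodesics and Alexandrov angles -/

/-- `γ`, restricted to `[0, d(p,q)]`, is a geodesic connecting `p` to `q`. -/
def IsGeodesic {M : Type*} [MetricSpace M] (γ : ℝ → M) (p q : M) : Prop :=
  γ 0 = p ∧ γ (dist p q) = q ∧
    ∀ s ∈ Set.Icc 0 (dist p q), ∀ t ∈ Set.Icc 0 (dist p q), dist (γ s) (γ t) = |s - t|

/-- Every two points are connected by a geodesic, and this geodesic, as a map on `[0, d(p,q)]`,
is unique. -/
def UniquelyGeodesic (M : Type*) [MetricSpace M] : Prop :=
  ∀ p q : M, ∃ γ : ℝ → M, IsGeodesic γ p q ∧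
    ∀ η : ℝ → M, IsGeodesic η p q → Set.EqOn η γ (Set.Icc 0 (dist p q))

open Classical in
/-- The geodesic connecting `p` to `q`; only its values on `[0, d(p,q)]` are meaningful, and there
they are determined by `p` and `q` in a uniquely geodesic space. -/
def geod {M : Type*} [MetricSpace M] (p q : M) : ℝ → M :=
  if h : ∃ γ : ℝ → M, IsGeodesic γ p q then h.choose else fun _ => p

/-- The comparison angle between `q` and `r` at `p`. -/
def comparisonAngle {M : Type*} [MetricSpace M] (p q r : M) : ℝ :=
  Real.arccos ((dist p q ^ 2 + dist p r ^ 2 - dist q r ^ 2) / (2 * dist p q * dist p r))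

/-- The Alexandrov angle between two geodesics emanating from `p`: the limit, as `r` decreases
to `0`, of the supremum of the comparison angles at `p` of `γ t` and `η s` over `0 < t, s < r`. -/
def geodesicAngle {M : Type*} [MetricSpace M] (p : M) (γ η : ℝ → M) : ℝ :=
  limUnder (𝓝[>] (0 : ℝ)) fun r : ℝ =>
    sSup {θ : ℝ | ∃ t s : ℝ, 0 < t ∧ t < r ∧ 0 < s ∧ s < r ∧
      θ = comparisonAngle p (γ t) (η s)}

/-- The Alexandrov angle `∠_p(q, r)`, meaningful for `q ≠ p` and `r ≠ p`. -/
def angle {M : Type*} [MetricSpace M] (p q r : M) : ℝ :=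
  geodesicAngle p (geod p q) (geod p r)

/-- The projection regularity condition with constant `C` and exponent `α`:
`|d(p,q) cos ∠_p(u,q) - d(p,r) cos ∠_p(u,r)| ≤ C d(q,r)^α`. The angles have no meaning at `u = p`,
so nothing is required there; at `q = p` or `r = p` the term containing the meaningless angle
has the factor `0`. -/
def ProjectionHolder (M : Type*) [MetricSpace M] (C α : ℝ) : Prop :=
  ∀ p q r u : M, u ≠ p →
    |dist p q * Real.cos (angle p u q) - dist p r * Real.cos (angle p u r)| ≤ C * dist q r ^ α

/-! ### The binary regression model -/

/-- The log odds `h(β; x, μ) = d(μ,x) d(μ,β) cos ∠_μ(x,β)`. -/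
def logOdds {M : Type*} [MetricSpace M] (β x μ : M) : ℝ :=
  dist μ x * dist μ β * Real.cos (angle μ x β)

/-- The Fréchet functional `p ↦ E[d²(p, X)]` for `X` with law `P`. -/
def frechetFunctional {M : Type*} [MetricSpace M] [MeasurableSpace M] (P : Measure M) (p : M) :
    ℝ≥0∞ :=
  ∫⁻ x, edist p x ^ 2 ∂P

/-- `μ` is a Fréchet mean of the law `P`, that is, a minimizer of the Fréchet functional. -/
def IsFrechetMean {M : Type*} [MetricSpace M] [MeasurableSpace M] (P : Measure M) (μ : M) : Prop :=
  ∀ p : M, frechetFunctional P μ ≤ frechetFunctional P p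

/-- The law of one observation `(X, Y)`, with `Y = true` standing for `Y = 1`: `X` has law `P`, and
given `X = x` the response equals `1` with the probability `p` for which
`log (p / (1 - p)) = h(β; x, μ)`, namely `p = 1 / (1 + exp (-h(β; x, μ)))`. -/
def observationLaw {M : Type*} [MetricSpace M] [MeasurableSpace M] (P : Measure M) (μ β : M) :
    Measure (M × Bool) :=
  (P.prod Measure.count).withDensity fun z =>
    ENNReal.ofReal (if z.2 then Real.sigmoid (logOdds β z.1 μ)
      else 1 - Real.sigmoid (logOdds β z.1 μ))

/-- The law of `n` i.i.d. observations. -/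
def sampleLaw {M : Type*} [MetricSpace M] [MeasurableSpace M] (P : Measure M) (μ β : M) (n : ℕ) :
    Measure (Fin n → M × Bool) :=
  Measure.pi fun _ => observationLaw P μ β

/-- The minimax risk for `n` observations: the infimum over all estimators (measurable maps from
samples to `M`) of the largest expected squared distance to the true parameter `β ∈ M`. -/
def minimaxRisk {M : Type*} [MetricSpace M] [MeasurableSpace M] (P : Measure M) (μ : M) (n : ℕ) :
    ℝ≥0∞ :=
  ⨅ (b : (Fin n → M × Bool) → M) (_ : Measurable b),
    ⨆ β : M, ∫⁻ z, edist β (b z) ^ 2 ∂(sampleLaw P μ β n)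

/-! ### Global metric entropy -/

/-- `N(ε, M, d) ≍ (1/ε)^D` as `ε` decreases to `0`, with constants `c₁` and `c₂`. -/
def LogPolynomialEntropy (M : Type*) [MetricSpace M] (c₁ c₂ D : ℝ) : Prop :=
  ∀ᶠ ε : ℝ≥0 in 𝓝[>] 0,
    Metric.coveringNumber ε (Set.univ : Set M) ≠ ⊤ ∧
    c₁ * (1 / (ε : ℝ)) ^ D ≤ ((Metric.coveringNumber ε (Set.univ : Set M)).toNat : ℝ) ∧
    ((Metric.coveringNumber ε (Set.univ : Set M)).toNat : ℝ) ≤ c₂ * (1 / (ε : ℝ)) ^ D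

/-- `log N(ε, M, d) ≍ (1/ε)^D` as `ε` decreases to `0`, with constants `c₁` and `c₂`. -/
def PolynomialEntropy (M : Type*) [MetricSpace M] (c₁ c₂ D : ℝ) : Prop :=
  ∀ᶠ ε : ℝ≥0 in 𝓝[>] 0,
    Metric.coveringNumber ε (Set.univ : Set M) ≠ ⊤ ∧
    c₁ * (1 / (ε : ℝ)) ^ D ≤ Real.log (Metric.coveringNumber ε (Set.univ : Set M)).toNat ∧
    Real.log (Metric.coveringNumber ε (Set.univ : Set M)).toNat ≤ c₂ * (1 / (ε : ℝ)) ^ D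

end

end MetricRegression

/-! The lower bound is a local testing argument. By pigeonhole, some ball of radius `δ` contains an
`ηδ`-separated set `T` with at least `N(ηδ) / N(δ)` points (`exists_separated_subset_closedBall`).
Projection regularity bounds the change of the log odds inside the ball by `d(μ, x)` times a
multiple of `C δ^α`, so the likelihood ratio against the law at the centre has second moment at most
`1 + 3 C² δ^(2α) σ²` per observation, hence at most `exp (3 C² δ^(2α) σ² n)` for the sample. If `T`
has at least four times that many points, its parameters cannot be told apart and the risk is at
least `(ηδ)² / 8` (`le_minimaxRisk_of_separated`).

It remains to choose `δ`. In (a) the exponent is made equal to `D`, in (b) equal to `δ^(-D)`; a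
small fixed `η` then makes the entropy ratio large enough. In (a), geodesics force `D ≥ 1`, which
lets `η` be chosen independently of `D`. -/

namespace MetricRegression

/-! ### Testing many hypotheses against one reference law -/

/-- For finite `x`, right minus left is the square `(m/2 - x)² / m`. It trades a likelihood ratio
for its second moment. -/
theorem ennreal_le_quarter_add_sq_div (x : ℝ≥0∞) {m : ℝ≥0∞} (hm : m ≠ 0) (hm' : m ≠ ⊤) :
    x ≤ m / 4 + x ^ 2 / m := by
  induction x with
  | top => simp [ENNReal.top_div, hm']
  | coe x =>
    lift m to ℝ≥0 using hm'
    have hm0 : m ≠ 0 := by simpa using hm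
    have h4 : ((4 : ℝ≥0) : ℝ≥0∞) = 4 := rfl
    rw [← h4, ← ENNReal.coe_div (by norm_num), ← ENNReal.coe_pow, ← ENNReal.coe_div hm0,
      ← ENNReal.coe_add, ENNReal.coe_le_coe, ← NNReal.coe_le_coe]
    push_cast
    have hpos : (0 : ℝ) < m := by positivity
    have : (m : ℝ) / 4 + x ^ 2 / m - x = (m / 2 - x) ^ 2 / m := by field_simp; ring
    have h2 : (0 : ℝ) ≤ (m / 2 - x) ^ 2 / m := by positivity
    linarith

/-- Testing bound: measures whose densities with respect to `Q` have second moment at most `B`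
cannot be told apart when there are at least `4 B` of them. -/
theorem sum_withDensity_le_card_div_two {Ω ι : Type*} [MeasurableSpace Ω] (Q : Measure Ω)
    [IsProbabilityMeasure Q] (T : Finset ι) (hT : T.Nonempty) (L : ι → Ω → ℝ≥0∞)
    (hL : ∀ i, Measurable (L i)) (A : ι → Set Ω) (hA : ∀ i, MeasurableSet (A i))
    (hdisj : (T : Set ι).PairwiseDisjoint A) (B : ℝ≥0∞) (hB : ∀ i ∈ T, ∫⁻ z, L i z ^ 2 ∂Q ≤ B)
    (hcard : 4 * B ≤ T.card) :
    ∑ i ∈ T, Q.withDensity (L i) (A i) ≤ (T.card : ℝ≥0∞) / 2 := by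
  set m : ℝ≥0∞ := (T.card : ℝ≥0∞) with hm
  have hm0 : m ≠ 0 := by simp [hm, hT.ne_empty]
  have hmt : m ≠ ⊤ := by simp [hm]
  -- Summed over `T`, the first terms give at most `m / 4` because the `A i` are disjoint, the
  -- second give `B ≤ m / 4`.
  have step : ∀ i ∈ T, Q.withDensity (L i) (A i) ≤ m / 4 * Q (A i) + B / m := by
    intro i hi
    rw [withDensity_apply _ (hA i)]
    calc ∫⁻ z in A i, L i z ∂Q ≤ ∫⁻ z in A i, (m / 4 + L i z ^ 2 / m) ∂Q :=
          lintegral_mono fun z => ennreal_le_quarter_add_sq_div _ hm0 hmt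
      _ = m / 4 * Q (A i) + (∫⁻ z in A i, L i z ^ 2 ∂Q) / m := by
          rw [lintegral_add_left measurable_const]
          simp only [lintegral_const, Measure.restrict_apply MeasurableSet.univ, Set.univ_inter,
            div_eq_mul_inv]
          rw [lintegral_mul_const _ ((hL i).pow_const 2)]
      _ ≤ m / 4 * Q (A i) + B / m := by
          gcongr
          exact (setLIntegral_le_lintegral _ _).trans (hB i hi)
  have hQ : ∑ i ∈ T, Q (A i) ≤ 1 := by
    rw [← measure_biUnion_finset hdisj fun i _ => hA i]
    exact prob_le_one
  calc ∑ i ∈ T, Q.withDensity (L i) (A i) ≤ ∑ i ∈ T, (m / 4 * Q (A i) + B / m) :=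
        Finset.sum_le_sum step
    _ = m / 4 * ∑ i ∈ T, Q (A i) + m * (B / m) := by
        rw [Finset.sum_add_distrib, ← Finset.mul_sum, Finset.sum_const, nsmul_eq_mul]
    _ ≤ m / 4 * 1 + m / 4 := by
        gcongr
        rw [ENNReal.mul_div_cancel hm0 hmt,
          ENNReal.le_div_iff_mul_le (Or.inl (by norm_num)) (Or.inl (by norm_num)), mul_comm]
        exact hcard
    _ = m / 2 := by
        rw [mul_one, ← ENNReal.add_div, ← two_mul, show (4 : ℝ≥0∞) = 2 * 2 by norm_num,
          ENNReal.mul_div_mul_left _ _ (by norm_num) (by norm_num)]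

/-! ### Product measures and their densities -/

theorem lintegral_pi_prod_eq_pow {Ω : Type*} [MeasurableSpace Ω] (Q : Measure Ω)
    [IsProbabilityMeasure Q] (n : ℕ) {f : Ω → ℝ≥0∞} (hf : Measurable f) :
    ∫⁻ z, ∏ i, f (z i) ∂(Measure.pi fun _ : Fin n => Q) = (∫⁻ x, f x ∂Q) ^ n := by
  have hind : ProbabilityTheory.iIndepFun (fun (i : Fin n) (z : Fin n → Ω) => f (z i))
      (Measure.pi fun _ : Fin n => Q) :=
    ProbabilityTheory.iIndepFun_pi (X := fun _ => f) fun _ => hf.aemeasurable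
  rw [ProbabilityTheory.lintegral_prod_eq_prod_lintegral_of_indepFun Finset.univ _ hind
    fun i => hf.comp (measurable_pi_apply i)]
  have : ∀ i : Fin n, ∫⁻ z, f (z i) ∂(Measure.pi fun _ : Fin n => Q) = ∫⁻ x, f x ∂Q := fun i =>
    (measurePreserving_eval (fun _ : Fin n => Q) i).lintegral_comp hf
  simp [this]

/-- It suffices to compare on rectangles, where the indicator times the product density factors over
independent coordinates. -/
theorem pi_withDensity_eq {Ω : Type*} [MeasurableSpace Ω] (Q : Measure Ω)
    [IsProbabilityMeasure Q] (n : ℕ) {f : Ω → ℝ≥0∞} (hf : Measurable f)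
    [IsProbabilityMeasure (Q.withDensity f)] :
    (Measure.pi fun _ : Fin n => Q.withDensity f) =
      (Measure.pi fun _ : Fin n => Q).withDensity fun z => ∏ i, f (z i) := by
  refine Measure.pi_eq fun s hs => ?_
  have hind : ProbabilityTheory.iIndepFun
      (fun (i : Fin n) (z : Fin n → Ω) => (s i).indicator f (z i))
      (Measure.pi fun _ : Fin n => Q) :=
    ProbabilityTheory.iIndepFun_pi (X := fun i => (s i).indicator f)
      fun i => (hf.indicator (hs i)).aemeasurable
  rw [withDensity_apply _ (MeasurableSet.univ_pi hs),
    ← lintegral_indicator (MeasurableSet.univ_pi hs)]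
  have : ∀ z : Fin n → Ω, (Set.univ.pi s).indicator (fun z => ∏ i, f (z i)) z =
      ∏ i, (s i).indicator f (z i) := by
    intro z
    by_cases h : z ∈ Set.univ.pi s
    · rw [Set.indicator_of_mem h]
      exact Finset.prod_congr rfl fun i _ => (Set.indicator_of_mem (h i trivial) _).symm
    · rw [Set.indicator_of_notMem h]
      simp only [Set.mem_pi, Set.mem_univ, true_imp_iff, not_forall] at h
      obtain ⟨i, hi⟩ := h
      exact (Finset.prod_eq_zero (Finset.mem_univ i) (Set.indicator_of_notMem hi _)).symm
  simp_rw [this]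
  rw [ProbabilityTheory.lintegral_prod_eq_prod_lintegral_of_indepFun Finset.univ _ hind
    fun i => (hf.indicator (hs i)).comp (measurable_pi_apply i)]
  refine Finset.prod_congr rfl fun i _ => ?_
  rw [withDensity_apply _ (hs i), ← lintegral_indicator (hs i)]
  exact (measurePreserving_eval (fun _ : Fin n => Q) i).lintegral_comp (hf.indicator (hs i))

/-! ### Chi-square bound for Bernoulli laws -/

/-- Second moment of the likelihood ratio of two Bernoulli laws in terms of their log odds. -/
theorem sigmoid_sq_div_add_le {a b : ℝ} (hab : |a - b| ≤ 1) :
    Real.sigmoid a ^ 2 / Real.sigmoid b + (1 - Real.sigmoid a) ^ 2 / (1 - Real.sigmoid b) ≤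
      1 + 3 * (a - b) ^ 2 := by
  set u := Real.exp (-b) with hu
  set v := Real.exp (-a) with hv
  have hu0 : 0 < u := Real.exp_pos _
  have hv0 : 0 < v := Real.exp_pos _
  have hpos : 0 < u * (1 + v) ^ 2 := by positivity
  have key : Real.sigmoid a ^ 2 / Real.sigmoid b + (1 - Real.sigmoid a) ^ 2 / (1 - Real.sigmoid b) =
      1 + (u - v) ^ 2 / (u * (1 + v) ^ 2) := by
    have h1 : 1 - (1 + u)⁻¹ = u / (1 + u) := by field_simp; ring
    have h2 : 1 - (1 + v)⁻¹ = v / (1 + v) := by field_simp; ring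
    rw [Real.sigmoid_def, Real.sigmoid_def, ← hu, ← hv, h1, h2]
    field_simp
    ring
  rw [key, add_le_add_iff_left, div_le_iff₀ hpos]
  have huv : u = v * Real.exp (a - b) := by rw [hu, hv, ← Real.exp_add]; ring_nf
  have hvu : v = u * Real.exp (b - a) := by rw [hu, hv, ← Real.exp_add]; ring_nf
  have hba : |b - a| ≤ 1 := by rwa [abs_sub_comm]
  have e1 : |Real.exp (b - a) - 1| ≤ 2 * |b - a| := Real.abs_exp_sub_one_le hba
  have e2 : (u - v) ^ 2 ≤ u ^ 2 * (4 * (a - b) ^ 2) := by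
    have : (u - v) ^ 2 = u ^ 2 * (Real.exp (b - a) - 1) ^ 2 := by rw [hvu]; ring
    rw [this]
    gcongr
    calc (Real.exp (b - a) - 1) ^ 2 = |Real.exp (b - a) - 1| ^ 2 := (sq_abs _).symm
      _ ≤ (2 * |b - a|) ^ 2 := by gcongr
      _ = 4 * (a - b) ^ 2 := by rw [mul_pow, sq_abs]; ring
  -- This is `exp 1 < 3`. Together with `4 v ≤ (1 + v)²` it turns the factor `4 u` into `3 (1 +
  -- v)²`, whence the constant `3`.
  have e3 : u ≤ 3 * v := by
    rw [huv, mul_comm]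
    gcongr
    exact (Real.exp_le_exp.2 ((le_abs_self _).trans hab)).trans
      (Real.exp_one_lt_d9.le.trans (by norm_num))
  have e4 : 4 * v ≤ (1 + v) ^ 2 := by nlinarith [sq_nonneg (1 - v)]
  calc (u - v) ^ 2 ≤ u ^ 2 * (4 * (a - b) ^ 2) := e2
    _ = (u * (a - b) ^ 2) * (4 * u) := by ring
    _ ≤ (u * (a - b) ^ 2) * (4 * (3 * v)) := by gcongr
    _ = (3 * (u * (a - b) ^ 2)) * (4 * v) := by ring
    _ ≤ (3 * (u * (a - b) ^ 2)) * (1 + v) ^ 2 := by gcongr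
    _ = _ := by ring

theorem lintegral_prod_count_bool {Ω : Type*} [MeasurableSpace Ω] (P : Measure Ω) [IsProbabilityMeasure P]
    {f : Ω × Bool → ℝ≥0∞} (hf : Measurable f) :
    ∫⁻ z, f z ∂(P.prod Measure.count) = ∫⁻ x, (f (x, true) + f (x, false)) ∂P := by
  rw [lintegral_prod _ hf.aemeasurable]
  refine lintegral_congr fun x => ?_
  rw [lintegral_count, tsum_bool, add_comm]

/-! ### Likelihood ratios in the regression model -/

section Model

variable {M : Type*} [MetricSpace M]

theorem comparisonAngle_comm (p q r : M) : comparisonAngle p q r = comparisonAngle p r q := by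
  unfold comparisonAngle
  rw [dist_comm q r]
  congr 1
  ring

theorem angle_comm (p q r : M) : angle p q r = angle p r q := by
  unfold angle geodesicAngle
  congr 1
  funext ρ
  congr 1
  ext θ
  constructor <;> rintro ⟨t, s, ht, htr, hs, hsr, rfl⟩ <;>
    exact ⟨s, t, hs, hsr, ht, htr, comparisonAngle_comm _ _ _⟩

theorem abs_logOdds_sub_le {C α : ℝ} (hM : ProjectionHolder M C α) (μ β β' x : M) :
    |logOdds β x μ - logOdds β' x μ| ≤ dist μ x * (C * dist β β' ^ α) := by
  rcases eq_or_ne x μ with rfl | hx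
  -- Regularity says nothing at `x = μ`, but there both log odds vanish.
  · simp [logOdds]
  · have := hM μ β β' x hx
    calc |logOdds β x μ - logOdds β' x μ|
        = |dist μ x * (dist μ β * Real.cos (angle μ x β)
            - dist μ β' * Real.cos (angle μ x β'))| := by unfold logOdds; ring_nf
      _ = dist μ x * |dist μ β * Real.cos (angle μ x β)
            - dist μ β' * Real.cos (angle μ x β')| := by rw [abs_mul, abs_of_nonneg dist_nonneg]
      _ ≤ _ := by gcongr

/-- The regularity condition varies the second argument of the angle. By symmetry of the angle it
applies to `x` too, with `u = β`. This supplies measurability of the model densities. -/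
theorem continuous_logOdds {C α : ℝ} (hα : 0 < α) (hM : ProjectionHolder M C α) (μ β : M) :
    Continuous fun x => logOdds β x μ := by
  rcases eq_or_ne β μ with rfl | hβ
  · simp only [logOdds, dist_self, mul_zero, zero_mul]
    exact continuous_const
  · have h : Continuous fun x => dist μ x * Real.cos (angle μ β x) := by
      refine continuous_iff_continuousAt.2 fun x => ?_
      refine tendsto_iff_dist_tendsto_zero.2 ?_
      refine squeeze_zero (fun _ => dist_nonneg) (g := fun y => C * dist y x ^ α)
        (fun y => by rw [Real.dist_eq]; exact hM μ y x β hβ) ?_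
      have hc : Continuous fun y => C * dist y x ^ α :=
        continuous_const.mul ((Real.continuous_rpow_const hα.le).comp
          (continuous_id.dist continuous_const))
      have := hc.tendsto x
      rwa [dist_self, Real.zero_rpow hα.ne', mul_zero] at this
    refine (continuous_const.mul h).congr (f := fun x => dist μ β * _) fun x => ?_
    rw [logOdds, angle_comm]
    ring

/-- The conditional probability of the response, given the covariate. -/
noncomputable def responseProb (μ β : M) (z : M × Bool) : ℝ :=
  if z.2 then Real.sigmoid (logOdds β z.1 μ) else 1 - Real.sigmoid (logOdds β z.1 μ)

theorem responseProb_pos (μ β : M) (z : M × Bool) : 0 < responseProb μ β z := by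
  unfold responseProb
  split_ifs
  · exact Real.sigmoid_pos _
  · exact sub_pos.2 (Real.sigmoid_lt_one _)

theorem observationLaw_eq [MeasurableSpace M] (P : Measure M) (μ β : M) :
    observationLaw P μ β =
      (P.prod Measure.count).withDensity fun z => ENNReal.ofReal (responseProb μ β z) := rfl

variable [MeasurableSpace M] [BorelSpace M]

theorem measurable_responseProb {C α : ℝ} (hα : 0 < α) (hM : ProjectionHolder M C α) (μ β : M) :
    Measurable (responseProb μ β) := by
  have h : Measurable fun z : M × Bool => Real.sigmoid (logOdds β z.1 μ) :=
    continuous_sigmoid.measurable.comp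
      ((continuous_logOdds hα hM μ β).measurable.comp measurable_fst)
  exact Measurable.ite (measurable_snd (measurableSet_singleton true)) h (measurable_const.sub h)

theorem isProbabilityMeasure_observationLaw {C α : ℝ} (hα : 0 < α)
    (hM : ProjectionHolder M C α) (P : Measure M) [IsProbabilityMeasure P] (μ β : M) :
    IsProbabilityMeasure (observationLaw P μ β) := by
  constructor
  rw [observationLaw_eq, withDensity_apply _ MeasurableSet.univ, Measure.restrict_univ,
    lintegral_prod_count_bool P (measurable_responseProb hα hM μ β).ennreal_ofReal]
  have : ∀ x : M, ENNReal.ofReal (responseProb μ β (x, true)) +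
      ENNReal.ofReal (responseProb μ β (x, false)) = 1 := by
    intro x
    rw [← ENNReal.ofReal_add (responseProb_pos _ _ _).le (responseProb_pos _ _ _).le]
    simp [responseProb]
  simp [this]

/-- The likelihood ratio of one observation. -/
noncomputable def likelihoodRatio (μ β₀ β : M) (z : M × Bool) : ℝ≥0∞ :=
  ENNReal.ofReal (responseProb μ β z / responseProb μ β₀ z)

theorem measurable_likelihoodRatio {C α : ℝ} (hα : 0 < α) (hM : ProjectionHolder M C α)
    (μ β₀ β : M) : Measurable (likelihoodRatio μ β₀ β) :=
  ((measurable_responseProb hα hM μ β).div (measurable_responseProb hα hM μ β₀)).ennreal_ofReal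

theorem observationLaw_withDensity {C α : ℝ} (hα : 0 < α) (hM : ProjectionHolder M C α)
    (P : Measure M) (μ β₀ β : M) :
    (observationLaw P μ β₀).withDensity (likelihoodRatio μ β₀ β) = observationLaw P μ β := by
  rw [observationLaw_eq, observationLaw_eq,
    ← withDensity_mul _ (measurable_responseProb hα hM μ β₀).ennreal_ofReal
      (measurable_likelihoodRatio hα hM μ β₀ β)]
  congr 1
  funext z
  have h0 := responseProb_pos μ β₀ z
  rw [Pi.mul_apply, likelihoodRatio, ← ENNReal.ofReal_mul h0.le, mul_div_cancel₀ _ h0.ne']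

/-- Conditionally on `x` the Bernoulli bound gives `1 + 3 (C δ^α)² d(μ, x)²`, and integrating `d(μ,
x)²` produces `σ²`. The diameter bound `R` only keeps the log odds differences below `1`. -/
theorem lintegral_likelihoodRatio_sq_le {C α : ℝ} (hα : 0 < α) (hM : ProjectionHolder M C α)
    (P : Measure M) [IsProbabilityMeasure P] (μ β₀ β : M) {σ : ℝ}
    (hσ : frechetFunctional P μ = ENNReal.ofReal (σ ^ 2)) {δ R : ℝ} (hC : 0 ≤ C) (hδ : 0 ≤ δ)
    (hβ : dist β₀ β ≤ δ) (hR : ∀ x, dist μ x ≤ R) (hsmall : R * (C * δ ^ α) ≤ 1) :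
    ∫⁻ z, likelihoodRatio μ β₀ β z ^ 2 ∂(observationLaw P μ β₀) ≤
      ENNReal.ofReal (1 + 3 * (C * δ ^ α) ^ 2 * σ ^ 2) := by
  have hm0 := (measurable_responseProb hα hM μ β₀).ennreal_ofReal
  have hm1 := (measurable_likelihoodRatio hα hM μ β₀ β).pow_const 2
  rw [observationLaw_eq, lintegral_withDensity_eq_lintegral_mul _ hm0 hm1,
    lintegral_prod_count_bool P (hm0.mul hm1)]
  have hz : ∀ z : M × Bool, ENNReal.ofReal (responseProb μ β₀ z) * likelihoodRatio μ β₀ β z ^ 2 =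
      ENNReal.ofReal (responseProb μ β z ^ 2 / responseProb μ β₀ z) := by
    intro z
    have h0 := responseProb_pos μ β₀ z
    have h1 := responseProb_pos μ β z
    rw [likelihoodRatio, ← ENNReal.ofReal_pow (by positivity), ← ENNReal.ofReal_mul h0.le]
    congr 1
    field_simp
  have hx : ∀ x : M, ENNReal.ofReal (responseProb μ β₀ (x, true)) *
        likelihoodRatio μ β₀ β (x, true) ^ 2 + ENNReal.ofReal (responseProb μ β₀ (x, false)) *
        likelihoodRatio μ β₀ β (x, false) ^ 2 ≤
      1 + ENNReal.ofReal (3 * (C * δ ^ α) ^ 2) * edist μ x ^ 2 := by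
    intro x
    have hδα : 0 ≤ C * δ ^ α := by positivity
    have hd : |logOdds β x μ - logOdds β₀ x μ| ≤ dist μ x * (C * δ ^ α) := by
      refine (abs_logOdds_sub_le hM μ β β₀ x).trans ?_
      rw [dist_comm β β₀]
      gcongr
    have hsm : |logOdds β x μ - logOdds β₀ x μ| ≤ 1 :=
      hd.trans ((mul_le_mul_of_nonneg_right (hR x) hδα).trans hsmall)
    rw [hz, hz, ← ENNReal.ofReal_add
      (div_nonneg (sq_nonneg _) (responseProb_pos _ _ _).le)
      (div_nonneg (sq_nonneg _) (responseProb_pos _ _ _).le),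
      edist_dist, ← ENNReal.ofReal_pow dist_nonneg, ← ENNReal.ofReal_mul (by positivity),
      ← ENNReal.ofReal_one, ← ENNReal.ofReal_add zero_le_one (by positivity)]
    refine ENNReal.ofReal_le_ofReal ?_
    have h := sigmoid_sq_div_add_le hsm
    simp only [responseProb, if_true, Bool.false_eq_true, if_false]
    refine h.trans ?_
    have : (logOdds β x μ - logOdds β₀ x μ) ^ 2 ≤ (dist μ x * (C * δ ^ α)) ^ 2 :=
      sq_le_sq' (abs_le.1 hd).1 (abs_le.1 hd).2
    nlinarith
  refine (lintegral_mono hx).trans ?_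
  rw [lintegral_add_left measurable_const, lintegral_const, measure_univ, one_mul,
    lintegral_const_mul' _ _ ENNReal.ofReal_ne_top]
  change 1 + ENNReal.ofReal (3 * (C * δ ^ α) ^ 2) * frechetFunctional P μ ≤ _
  rw [hσ, ← ENNReal.ofReal_mul (by positivity), ← ENNReal.ofReal_one,
    ← ENNReal.ofReal_add zero_le_one (by positivity)]

/-! ### Risk bound from a separated set -/

/-- Minimax lower bound from a large separated set of parameters in a small ball. -/
theorem le_minimaxRisk_of_separated {C α : ℝ} (hα : 0 < α) (hC : 0 ≤ C)
    (hM : ProjectionHolder M C α)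
    (P : Measure M) [IsProbabilityMeasure P] (μ β₀ : M) {σ : ℝ}
    (hσ : frechetFunctional P μ = ENNReal.ofReal (σ ^ 2)) {δ R s : ℝ} (hδ : 0 ≤ δ) (hs : 0 < s)
    (hR : ∀ x, dist μ x ≤ R) (hsmall : R * (C * δ ^ α) ≤ 1) (T : Finset M)
    (hT : ∀ β ∈ T, dist β₀ β ≤ δ)
    (hsep : ∀ β ∈ T, ∀ β' ∈ T, β ≠ β' → s < dist β β') (n : ℕ)
    (hcard : 4 * Real.exp (3 * (C * δ ^ α) ^ 2 * σ ^ 2 * n) ≤ T.card) :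
    ENNReal.ofReal (s ^ 2 / 8) ≤ minimaxRisk P μ n := by
  have hTne : T.Nonempty := by
    rw [← Finset.card_pos, ← Nat.cast_pos (α := ℝ)]
    exact lt_of_lt_of_le (by positivity) hcard
  have hprob := isProbabilityMeasure_observationLaw hα hM P μ
  refine le_iInf fun b => le_iInf fun hb => ?_
  set S := ⨆ β : M, ∫⁻ z, edist β (b z) ^ 2 ∂(sampleLaw P μ β n) with hS
  set Q : Measure (Fin n → M × Bool) := sampleLaw P μ β₀ n with hQ
  have : IsProbabilityMeasure Q := by rw [hQ, sampleLaw]; infer_instance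
  have hlaw : ∀ β, sampleLaw P μ β n =
      Q.withDensity fun z => ∏ i, likelihoodRatio μ β₀ β (z i) := by
    intro β
    have h := observationLaw_withDensity hα hM P μ β₀ β
    have : IsProbabilityMeasure
        ((observationLaw P μ β₀).withDensity (likelihoodRatio μ β₀ β)) := by rw [h]; exact hprob β
    rw [hQ, sampleLaw, sampleLaw, ← h]
    exact pi_withDensity_eq _ n (measurable_likelihoodRatio hα hM μ β₀ β)
  set ε : ℝ≥0∞ := ENNReal.ofReal (s / 2) with hε
  have hdist : ∀ β, Measurable fun z => edist β (b z) := fun β =>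
    (continuous_const.edist continuous_id).measurable.comp hb
  -- The estimator is within `s / 2` of `β`; since `T` is `s`-separated, it cannot be this close to
  -- two points of `T`.
  set A : M → Set (Fin n → M × Bool) := fun β => {z | edist β (b z) < ε} with hAdef
  have hA : ∀ β, MeasurableSet (A β) := fun β => measurableSet_lt (hdist β) measurable_const
  have hdisj : (T : Set M).PairwiseDisjoint A := by
    intro β hβ β' hβ' hne
    refine Set.disjoint_left.2 fun z hz hz' => ?_
    have h1 : edist β (b z) < ε := hz
    have h2 : edist β' (b z) < ε := hz'
    rw [hε, edist_dist, ENNReal.ofReal_lt_ofReal_iff (by positivity)] at h1 h2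
    have := hsep β hβ β' hβ' hne
    have := dist_triangle_right β β' (b z)
    linarith
  have htest := sum_withDensity_le_card_div_two Q T hTne
    (fun β z => ∏ i, likelihoodRatio μ β₀ β (z i))
    (fun β => Finset.measurable_fun_prod _ fun i _ =>
      (measurable_likelihoodRatio hα hM μ β₀ β).comp (measurable_pi_apply i)) A hA hdisj
    (ENNReal.ofReal (Real.exp (3 * (C * δ ^ α) ^ 2 * σ ^ 2 * n))) (by
      intro β hβ
      simp_rw [← Finset.prod_pow]
      rw [hQ, sampleLaw, lintegral_pi_prod_eq_pow _ n
        ((measurable_likelihoodRatio hα hM μ β₀ β).pow_const 2)]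
      refine (pow_le_pow_left' (lintegral_likelihoodRatio_sq_le hα hM P μ β₀ β hσ hC hδ (hT β hβ)
        hR hsmall) n).trans ?_
      rw [← ENNReal.ofReal_pow (by positivity)]
      refine ENNReal.ofReal_le_ofReal ?_
      rw [mul_comm _ (n : ℝ), Real.exp_nat_mul]
      refine pow_le_pow_left₀ (by positivity) ?_ n
      rw [add_comm]
      exact Real.add_one_le_exp _) (by
      rw [← ENNReal.ofReal_natCast, ← ENNReal.ofReal_ofNat 4, ← ENNReal.ofReal_mul (by norm_num)]
      exact ENNReal.ofReal_le_ofReal hcard)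
  simp_rw [← hlaw] at htest
  have hsp : ∀ β, IsProbabilityMeasure (sampleLaw P μ β n) := fun β => by
    rw [sampleLaw]; infer_instance
  have hrisk : ∀ β, ε ^ 2 * sampleLaw P μ β n (A β)ᶜ ≤ S := by
    intro β
    refine le_trans ?_ (le_iSup (fun β => ∫⁻ z, edist β (b z) ^ 2 ∂(sampleLaw P μ β n)) β)
    refine le_trans ?_ (mul_meas_ge_le_lintegral ((hdist β).pow_const 2) (ε ^ 2))
    gcongr
    intro z hz
    have : ε ≤ edist β (b z) := not_lt.1 hz
    exact pow_le_pow_left' this 2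
  have hmt : (T.card : ℝ≥0∞) ≠ ⊤ := ENNReal.natCast_ne_top _
  have hm0 : (T.card : ℝ≥0∞) ≠ 0 := by simpa using hTne.ne_empty
  -- At least half of the total probability is failure, and each failure costs `ε² = s² / 4`;
  -- averaging over `T` yields `s² / 8`.
  have hcompl : (T.card : ℝ≥0∞) / 2 ≤ ∑ β ∈ T, sampleLaw P μ β n (A β)ᶜ := by
    have htot : (T.card : ℝ≥0∞) =
        ∑ β ∈ T, sampleLaw P μ β n (A β) + ∑ β ∈ T, sampleLaw P μ β n (A β)ᶜ := by
      rw [← Finset.sum_add_distrib]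
      simp [measure_add_measure_compl (hA _)]
    have h2 : (T.card : ℝ≥0∞) / 2 + (T.card : ℝ≥0∞) / 2 ≤
        (T.card : ℝ≥0∞) / 2 + ∑ β ∈ T, sampleLaw P μ β n (A β)ᶜ := by
      rw [ENNReal.add_halves]
      exact htot.le.trans (by gcongr)
    exact (ENNReal.add_le_add_iff_left (ENNReal.div_ne_top hmt (by norm_num))).1 h2
  have hfinal : (T.card : ℝ≥0∞) * (ε ^ 2 / 2) ≤ T.card * S :=
    calc (T.card : ℝ≥0∞) * (ε ^ 2 / 2) = ε ^ 2 * (T.card / 2) := by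
          simp only [div_eq_mul_inv]; ring
      _ ≤ ε ^ 2 * ∑ β ∈ T, sampleLaw P μ β n (A β)ᶜ := by gcongr
      _ = ∑ β ∈ T, ε ^ 2 * sampleLaw P μ β n (A β)ᶜ := Finset.mul_sum _ _ _
      _ ≤ ∑ β ∈ T, S := Finset.sum_le_sum fun β _ => hrisk β
      _ = T.card * S := by rw [Finset.sum_const, nsmul_eq_mul]
  have := (ENNReal.mul_le_mul_iff_right hm0 hmt).1 hfinal
  refine le_trans (le_of_eq ?_) this
  rw [hε, ← ENNReal.ofReal_pow (by positivity), ← ENNReal.ofReal_ofNat 2,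
    ← ENNReal.ofReal_div_of_pos (by norm_num)]
  congr 1
  ring

end Model

/-! ### Covering numbers, separated sets and geodesics -/

/-- Some ball of radius `δ` contains an `ε`-separated set of at least `N(ε) / N(δ)` points. -/
theorem exists_separated_subset_closedBall {M : Type*} [MetricSpace M] (ε δ : ℝ≥0)
    (hδ : Metric.coveringNumber δ (Set.univ : Set M) ≠ ⊤) [Nonempty M] :
    ∃ (x : M) (T : Finset M), (∀ β ∈ T, dist x β ≤ δ) ∧
      (∀ β ∈ T, ∀ β' ∈ T, β ≠ β' → (ε : ℝ) < dist β β') ∧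
      (Metric.coveringNumber ε (Set.univ : Set M)).toNat ≤
        (Metric.coveringNumber δ (Set.univ : Set M)).toNat * T.card := by
  classical
  obtain ⟨C, -, hCfin, hCcov, hCcard⟩ := Metric.exists_set_encard_eq_coveringNumber hδ
  have hC : C.Nonempty := hCcov.nonempty Set.univ_nonempty
  -- Otherwise, maximal separated subsets of the `N(δ)` balls, being covers of these balls at scale
  -- `ε`, would together cover `M` with fewer than `N(ε)` points.
  by_contra! hcon
  set N := (Metric.coveringNumber ε (Set.univ : Set M)).toNat
  have hball : ∀ x : M, ∃ S : Set M, S.Finite ∧ Metric.IsCover ε (Metric.closedBall x δ) S ∧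
      (Metric.coveringNumber δ (Set.univ : Set M)).toNat * S.ncard < N := by
    intro x
    have hfin : ∀ S ⊆ Metric.closedBall x δ, Metric.IsSeparated ε S → S.Finite →
        (Metric.coveringNumber δ (Set.univ : Set M)).toNat * S.ncard < N := by
      intro S hS hsep hSfin
      have := hcon x hSfin.toFinset (fun β hβ => by
        rw [dist_comm]; exact hS (hSfin.mem_toFinset.1 hβ)) (fun β hβ β' hβ' hne => by
        have : (ε : ℝ≥0∞) < edist β β' :=
          hsep (hSfin.mem_toFinset.1 hβ) (hSfin.mem_toFinset.1 hβ') hne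
        rw [edist_dist, ← ENNReal.ofReal_coe_nnreal] at this
        exact (ENNReal.ofReal_lt_ofReal_iff_of_nonneg ε.2).1 this)
      rwa [← Set.ncard_eq_toFinset_card S hSfin] at this
    have hpack : Metric.packingNumber ε (Metric.closedBall x δ) ≠ ⊤ := by
      -- A larger separated set would contain one with exactly `N` points, giving `N(δ) * N < N`
      -- although `N(δ) ≥ 1`.
      have hle : Metric.packingNumber ε (Metric.closedBall x δ) ≤ N := by
        refine iSup_le fun S => iSup_le fun hS => iSup_le fun hsep => ?_
        by_contra! hlt
        obtain ⟨S', hS'S, hS'card⟩ := Set.exists_subset_encard_eq hlt.le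
        have hS'fin : S'.Finite := Set.finite_of_encard_eq_coe hS'card
        have := hfin S' (hS'S.trans hS) (hsep.subset hS'S) hS'fin
        have h1 : S'.ncard = N := by rw [Set.ncard, hS'card]; simp
        have h2 : 1 ≤ (Metric.coveringNumber δ (Set.univ : Set M)).toNat := by
          rw [← hCcard]
          exact (Set.ncard_pos hCfin).2 hC
        rw [h1] at this
        nlinarith
      exact ne_top_of_le_ne_top (ENat.natCast_ne_top _) hle
    refine ⟨Metric.maximalSeparatedSet ε (Metric.closedBall x δ), ?_,
      Metric.isCover_maximalSeparatedSet hpack, ?_⟩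
    · rw [← Set.encard_ne_top_iff, Metric.encard_maximalSeparatedSet hpack]
      exact hpack
    · refine hfin _ Metric.maximalSeparatedSet_subset Metric.isSeparated_maximalSeparatedSet ?_
      rw [← Set.encard_ne_top_iff, Metric.encard_maximalSeparatedSet hpack]
      exact hpack
  choose S hSfin hScov hScard using hball
  have hCn : hCfin.toFinset.card = (Metric.coveringNumber δ (Set.univ : Set M)).toNat := by
    rw [← hCcard, ← Set.ncard_eq_toFinset_card C hCfin, Set.ncard]
  set U : Finset M := hCfin.toFinset.biUnion fun x => (hSfin x).toFinset with hU
  have hUcov : Metric.IsCover ε (Set.univ : Set M) (U : Set M) := by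
    intro y _
    obtain ⟨x, hx, hxy⟩ := hCcov (Set.mem_univ y)
    have hy : y ∈ Metric.closedBall x δ := by
      rw [Metric.mem_closedBall, dist_edist]
      exact ENNReal.toReal_le_of_le_ofReal δ.2 (by simpa using hxy)
    obtain ⟨z, hz, hzy⟩ := hScov x hy
    exact ⟨z, by simp only [hU, Finset.coe_biUnion, Set.mem_iUnion]; exact ⟨x, by simpa using hx,
      by simpa using hz⟩, hzy⟩
  have hN : N ≤ U.card := by
    have := hUcov.coveringNumber_le_encard (Set.subset_univ _)
    rw [Set.encard_coe_eq_coe_finsetCard] at this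
    exact ENat.toNat_le_of_le_natCast this
  have hne : hCfin.toFinset.Nonempty := by simpa using hC
  have hUcard : U.card ≤ ∑ x ∈ hCfin.toFinset, (S x).ncard := by
    refine Finset.card_biUnion_le.trans_eq (Finset.sum_congr rfl fun x _ => ?_)
    rw [Set.ncard_eq_toFinset_card _ (hSfin x)]
  have h3 : ∑ x ∈ hCfin.toFinset, hCfin.toFinset.card * (S x).ncard <
      ∑ x ∈ hCfin.toFinset, N :=
    Finset.sum_lt_sum_of_nonempty hne fun x _ => hCn ▸ hScard x
  rw [← Finset.mul_sum, Finset.sum_const, smul_eq_mul] at h3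
  exact absurd (lt_of_mul_lt_mul_left h3 (Nat.zero_le _)) (not_lt.2 (hN.trans hUcard))

/-- A uniquely geodesic space with two points has covering numbers of order at least `1 / ε`. -/
theorem dist_le_coveringNumber_mul {M : Type*} [MetricSpace M] (hM : UniquelyGeodesic M)
    (p q : M) (ε : ℝ≥0) (hε : Metric.coveringNumber ε (Set.univ : Set M) ≠ ⊤) :
    dist p q ≤ (Metric.coveringNumber ε (Set.univ : Set M)).toNat * (2 * (ε : ℝ)) := by
  obtain ⟨γ, ⟨hγ0, -, hγ⟩, -⟩ := hM p q
  obtain ⟨C, -, hCfin, hCcov, hCcard⟩ := Metric.exists_set_encard_eq_coveringNumber hε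
  -- The 1-Lipschitz function `dist p` sends the geodesic onto `[0, d(p,q)]` and each covering ball
  -- into an interval of length `2ε`; lengths are then compared.
  have hsub : Set.Icc 0 (dist p q) ⊆
      ⋃ c ∈ hCfin.toFinset, Metric.closedBall (dist p c) (ε : ℝ) := by
    intro t ht
    obtain ⟨c, hc, htc⟩ := hCcov (Set.mem_univ (γ t))
    have h1 : dist p (γ t) = t := by
      have := hγ 0 ⟨le_rfl, dist_nonneg⟩ t ht
      rwa [hγ0, zero_sub, abs_neg, abs_of_nonneg ht.1] at this
    have h2 : dist (γ t) c ≤ ε := by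
      rw [dist_edist]
      exact ENNReal.toReal_le_of_le_ofReal ε.2 (by simpa using htc)
    simp only [Set.mem_iUnion]
    refine ⟨c, by simpa using hc, ?_⟩
    rw [Metric.mem_closedBall, Real.dist_eq, ← h1, dist_comm p (γ t), dist_comm p c]
    exact (abs_dist_sub_le _ _ _).trans h2
  have hvol := (measure_mono (μ := volume) hsub).trans (measure_biUnion_finset_le _ _)
  simp only [Real.volume_Icc, sub_zero, Real.volume_closedBall, Finset.sum_const,
    nsmul_eq_mul] at hvol
  rw [← hCcard]
  change dist p q ≤ (C.ncard : ℝ) * _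
  rw [Set.ncard_eq_toFinset_card C hCfin]
  rw [← ENNReal.ofReal_natCast, ← ENNReal.ofReal_mul (by positivity)] at hvol
  exact (ENNReal.ofReal_le_ofReal_iff (by positivity)).1 hvol

theorem exists_dist_le_of_coveringNumber_ne_top {M : Type*} [MetricSpace M] (ε : ℝ≥0)
    (hε : Metric.coveringNumber ε (Set.univ : Set M) ≠ ⊤) (p : M) :
    ∃ R : ℝ, 0 < R ∧ ∀ x, dist p x ≤ R := by
  obtain ⟨C, -, hCfin, hCcov, -⟩ := Metric.exists_set_encard_eq_coveringNumber hε
  obtain ⟨R, hR⟩ := (hCfin.image (dist p)).bddAbove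
  refine ⟨max R 0 + ε + 1, by positivity, fun x => ?_⟩
  obtain ⟨c, hc, hxc⟩ := hCcov (Set.mem_univ x)
  have h2 : dist x c ≤ ε := by
    rw [dist_edist]
    exact ENNReal.toReal_le_of_le_ofReal ε.2 (by simpa using hxc)
  have h1 := hR ⟨c, hc, rfl⟩
  have := dist_triangle_right p x c
  have := le_max_left R 0
  linarith

/-- If `D < 1`, the geodesic bound gives `d(p,q) ≤ 2 c₂ ε^(1-D)`, which tends to `0`. -/
theorem one_le_of_logPolynomialEntropy {M : Type*} [MetricSpace M] (hM : UniquelyGeodesic M)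
    {c₁ c₂ D : ℝ} (hN : LogPolynomialEntropy M c₁ c₂ D) {p q : M} (hpq : p ≠ q) : 1 ≤ D := by
  by_contra! hD
  have hev : ∀ᶠ ε : ℝ≥0 in 𝓝[>] 0, dist p q ≤ c₂ * 2 * (ε : ℝ) ^ (1 - D) := by
    filter_upwards [hN, self_mem_nhdsWithin] with ε hε hpos
    have hpos' : (0 : ℝ) < ε := hpos
    have h1 := dist_le_coveringNumber_mul hM p q ε hε.1
    refine h1.trans ((mul_le_mul_of_nonneg_right hε.2.2 (by positivity)).trans_eq ?_)
    rw [one_div, Real.inv_rpow hpos'.le, Real.rpow_sub hpos', Real.rpow_one]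
    ring
  have hlim : Tendsto (fun ε : ℝ≥0 => c₂ * 2 * (ε : ℝ) ^ (1 - D)) (𝓝[>] 0) (𝓝 0) := by
    have hc : Continuous fun ε : ℝ≥0 => c₂ * 2 * (ε : ℝ) ^ (1 - D) :=
      continuous_const.mul ((Real.continuous_rpow_const (by linarith)).comp NNReal.continuous_coe)
    have := hc.tendsto 0
    rw [NNReal.coe_zero, Real.zero_rpow (by linarith), mul_zero] at this
    exact this.mono_left nhdsWithin_le_nhds
  exact absurd (ge_of_tendsto hlim hev) (not_le.2 (dist_pos.2 hpq))

/-! ### Choice of the radius and the two rates -/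

section Asymptotics

variable {M : Type*} [MetricSpace M] [MeasurableSpace M] [BorelSpace M]

theorem le_minimaxRisk_of_coveringNumber {C α : ℝ} (hα : 0 < α) (hC : 0 ≤ C)
    (hM : ProjectionHolder M C α) (P : Measure M) [IsProbabilityMeasure P] (μ : M) {σ : ℝ}
    (hσ : frechetFunctional P μ = ENNReal.ofReal (σ ^ 2)) {ε δ : ℝ≥0} {R : ℝ} (hε : 0 < ε)
    (hN : Metric.coveringNumber δ (Set.univ : Set M) ≠ ⊤)
    (hR : ∀ x, dist μ x ≤ R) (hsmall : R * (C * (δ : ℝ) ^ α) ≤ 1) (n : ℕ)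
    (hratio : 4 * Real.exp (3 * (C * (δ : ℝ) ^ α) ^ 2 * σ ^ 2 * n) *
        (Metric.coveringNumber δ (Set.univ : Set M)).toNat ≤
      (Metric.coveringNumber ε (Set.univ : Set M)).toNat) :
    ENNReal.ofReal ((ε : ℝ) ^ 2 / 8) ≤ minimaxRisk P μ n := by
  have : Nonempty M := ⟨μ⟩
  obtain ⟨x, T, hT, hsep, hcard⟩ := exists_separated_subset_closedBall (M := M) ε δ hN
  refine le_minimaxRisk_of_separated hα hC hM P μ x hσ δ.2 hε hR hsmall T hT hsep n ?_
  have hpos : (0 : ℝ) < (Metric.coveringNumber δ (Set.univ : Set M)).toNat := by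
    rw [Nat.cast_pos, Nat.pos_iff_ne_zero, Ne, ENat.toNat_eq_zero, not_or]
    exact ⟨(Metric.coveringNumber_pos_iff.2 Set.univ_nonempty).ne', hN⟩
  have hcard' : ((Metric.coveringNumber ε (Set.univ : Set M)).toNat : ℝ) ≤
      T.card * (Metric.coveringNumber δ (Set.univ : Set M)).toNat := by
    rw [mul_comm]
    exact_mod_cast hcard
  exact le_of_mul_le_mul_right (hratio.trans hcard') hpos

/-- The radius is `δ = (A / n)^κ` and the separation `η δ`. Since `δ → 0` and `M` is bounded, the
smallness condition on the log odds holds eventually, whatever `P` is. -/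
theorem eventually_le_minimaxRisk {C α : ℝ} (hα : 0 < α) (hC : 0 ≤ C)
    (hM : ProjectionHolder M C α) (P : Measure M) [IsProbabilityMeasure P] (μ : M) {σ : ℝ}
    (hσ : frechetFunctional P μ = ENNReal.ofReal (σ ^ 2)) {A κ : ℝ} {η : ℝ≥0} (hA : 0 < A)
    (hκ : 0 < κ) (hη : 0 < η)
    (h : ∀ᶠ δ : ℝ≥0 in 𝓝[>] 0, Metric.coveringNumber δ (Set.univ : Set M) ≠ ⊤ ∧
      ∀ n : ℕ, 0 < n → (δ : ℝ) = (A / n) ^ κ →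
        4 * Real.exp (3 * (C * (δ : ℝ) ^ α) ^ 2 * σ ^ 2 * n) *
          (Metric.coveringNumber δ (Set.univ : Set M)).toNat ≤
        (Metric.coveringNumber (η * δ) (Set.univ : Set M)).toNat) :
    ∀ᶠ n : ℕ in atTop, ENNReal.ofReal (((η : ℝ) * (A / n) ^ κ) ^ 2 / 8) ≤ minimaxRisk P μ n := by
  obtain ⟨ε₀, hε₀⟩ := h.exists
  obtain ⟨R, hR0, hR⟩ := exists_dist_le_of_coveringNumber_ne_top ε₀ hε₀.1 μ
  set d : ℕ → ℝ≥0 := fun n => ((A / n) ^ κ).toNNReal with hd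
  have hdn : ∀ n, (d n : ℝ) = (A / n) ^ κ := fun n => Real.coe_toNNReal _ (by positivity)
  have hd0 : Tendsto d atTop (𝓝 0) := by
    rw [← NNReal.tendsto_coe]
    simp_rw [hdn]
    have := (tendsto_const_div_atTop_nhds_zero_nat A).rpow_const (p := κ) (Or.inr hκ.le)
    rwa [Real.zero_rpow hκ.ne'] at this
  have hdpos : ∀ᶠ n in atTop, d n ∈ Set.Ioi (0 : ℝ≥0) := by
    filter_upwards [eventually_gt_atTop 0] with n hn
    have : (0 : ℝ) < d n := by
      rw [hdn]
      have : (0 : ℝ) < n := by exact_mod_cast hn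
      positivity
    exact this
  have hdt : Tendsto d atTop (𝓝[>] 0) := tendsto_nhdsWithin_iff.2 ⟨hd0, hdpos⟩
  have hsmall : ∀ᶠ n in atTop, R * (C * (d n : ℝ) ^ α) ≤ 1 := by
    have h1 : Tendsto (fun n => R * (C * (d n : ℝ) ^ α)) atTop (𝓝 0) := by
      have := (((NNReal.tendsto_coe.2 hd0).rpow_const (p := α) (Or.inr hα.le)).const_mul
        C).const_mul R
      rwa [NNReal.coe_zero, Real.zero_rpow hα.ne', mul_zero, mul_zero] at this
    exact (h1.eventually (gt_mem_nhds one_pos)).mono fun _ => le_of_lt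
  filter_upwards [hdt.eventually h, hsmall, hdpos, eventually_gt_atTop 0] with n hn hs hp hn0
  have := le_minimaxRisk_of_coveringNumber hα hC hM P μ hσ (mul_pos hη hp) hn.1 hR hs n
    (hn.2 n hn0 (hdn n))
  rwa [NNReal.coe_mul, hdn] at this

omit [BorelSpace M] in
theorem exists_ne_of_frechetFunctional {P : Measure M} {μ : M} {σ : ℝ} (hσ : 0 < σ)
    (h : frechetFunctional P μ = ENNReal.ofReal (σ ^ 2)) : ∃ q, μ ≠ q := by
  by_contra! hall
  have h0 : frechetFunctional P μ = 0 := by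
    unfold frechetFunctional
    simp [← hall]
  rw [h0, eq_comm, ENNReal.ofReal_eq_zero] at h
  nlinarith [sq_pos_of_pos hσ]

theorem tendsto_mul_nhdsGT_zero {η : ℝ≥0} (hη : 0 < η) :
    Tendsto (fun δ : ℝ≥0 => η * δ) (𝓝[>] 0) (𝓝[>] 0) := by
  refine tendsto_nhdsWithin_iff.2 ⟨?_, ?_⟩
  · have : Tendsto (fun δ : ℝ≥0 => η * δ) (𝓝 0) (𝓝 (η * 0)) :=
      (continuous_const.mul continuous_id).tendsto 0
    rw [mul_zero] at this
    exact this.mono_left nhdsWithin_le_nhds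
  · filter_upwards [self_mem_nhdsWithin] with δ hδ
    exact mul_pos hη hδ

theorem eventually_le_minimaxRisk_of_logPolynomialEntropy {C α c₁ c₂ D : ℝ} (hα : 0 < α)
    (hC : 0 < C) (hc₁ : 0 < c₁) (hc₂ : 0 < c₂) (hM : ProjectionHolder M C α)
    (hG : UniquelyGeodesic M) (hN : LogPolynomialEntropy M c₁ c₂ D)
    (P : Measure M) [IsProbabilityMeasure P] (μ : M) {σ : ℝ} (hσ0 : 0 < σ)
    (hσ : frechetFunctional P μ = ENNReal.ofReal (σ ^ 2)) :
    ∀ᶠ n : ℕ in atTop, ENNReal.ofReal ((c₁ / (4 * Real.exp 1 * c₂)) ^ 2 / 8 *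
      (1 / (3 * C ^ 2)) ^ (1 / α) * (D / (σ ^ 2 * n)) ^ (1 / α)) ≤ minimaxRisk P μ n := by
  obtain ⟨q, hq⟩ := exists_ne_of_frechetFunctional hσ0 hσ
  have hD : 1 ≤ D := one_le_of_logPolynomialEntropy hG hN hq
  have hD0 : 0 < D := by linarith
  have hc : c₁ ≤ c₂ := by
    obtain ⟨ε, hε, hpos⟩ := (hN.and self_mem_nhdsWithin).exists
    have hpos' : (0 : ℝ) < ε := hpos
    exact le_of_mul_le_mul_right (hε.2.1.trans hε.2.2) (by positivity)
  -- Then `(1 / e)^D = exp D * (4 c₂ / c₁)^D`, and the last power is at least `4 c₂ / c₁` because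
  -- its base and `D` are at least `1`.
  set e : ℝ := c₁ / (4 * Real.exp 1 * c₂) with he
  have he0 : 0 < e := by positivity
  set η : ℝ≥0 := e.toNNReal with hηdef
  have hη : (η : ℝ) = e := Real.coe_toNNReal _ he0.le
  have hη0 : 0 < η := Real.toNNReal_pos.2 he0
  have hconst : 4 * Real.exp D * c₂ ≤ c₁ * (1 / e) ^ D := by
    have h1 : 1 / e = Real.exp 1 * (4 * c₂ / c₁) := by rw [he]; field_simp
    have h2 : 1 ≤ 4 * c₂ / c₁ := by rw [le_div_iff₀ hc₁]; linarith
    rw [h1, Real.mul_rpow (Real.exp_pos _).le (by positivity), Real.exp_one_rpow]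
    have h3 := Real.rpow_le_rpow_of_exponent_le h2 hD
    rw [Real.rpow_one] at h3
    calc 4 * Real.exp D * c₂ = c₁ * (Real.exp D * (4 * c₂ / c₁)) := by field_simp
      _ ≤ _ := by gcongr
  -- `A` and `κ` solve `3 C² δ^(2α) σ² n = D`.
  have key := eventually_le_minimaxRisk hα hC.le hM P μ hσ (A := D / (3 * C ^ 2 * σ ^ 2))
    (κ := 1 / (2 * α)) (η := η) (by positivity) (by positivity) hη0 (by
      filter_upwards [hN, (tendsto_mul_nhdsGT_zero hη0).eventually hN, self_mem_nhdsWithin]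
        with δ h1 h2 hδ
      refine ⟨h1.1, fun n hn hδn => ?_⟩
      have hδ0 : (0 : ℝ) < δ := hδ
      have hn' : (0 : ℝ) < n := by exact_mod_cast hn
      have hexp : 3 * (C * (δ : ℝ) ^ α) ^ 2 * σ ^ 2 * n = D := by
        have : ((δ : ℝ) ^ α) ^ 2 = D / (3 * C ^ 2 * σ ^ 2) / n := by
          rw [hδn, ← Real.rpow_mul (by positivity), ← Real.rpow_mul_natCast (by positivity)]
          have : 1 / (2 * α) * α * ((2 : ℕ) : ℝ) = 1 := by push_cast; field_simp
          rw [this, Real.rpow_one]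
        rw [mul_pow, this]
        field_simp
      rw [hexp]
      refine le_trans ?_ h2.2.1
      refine (mul_le_mul_of_nonneg_left h1.2.2 (by positivity)).trans ?_
      rw [NNReal.coe_mul, hη, ← one_div_mul_one_div, Real.mul_rpow (by positivity) (by positivity),
        ← mul_assoc, ← mul_assoc]
      gcongr)
  filter_upwards [key] with n hn
  refine le_trans (le_of_eq ?_) hn
  congr 1
  have hA : D / (3 * C ^ 2 * σ ^ 2) / n = 1 / (3 * C ^ 2) * (D / (σ ^ 2 * n)) := by
    simp only [div_eq_mul_inv, mul_inv]; ring
  rw [hη, mul_pow, ← Real.rpow_mul_natCast (by positivity)]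
  have : 1 / (2 * α) * ((2 : ℕ) : ℝ) = 1 / α := by push_cast; field_simp
  rw [this, hA, Real.mul_rpow (by positivity) (by positivity)]
  ring

theorem eventually_le_minimaxRisk_of_polynomialEntropy {C α c₁ c₂ D : ℝ} (hα : 0 < α)
    (hC : 0 < C) (hc₁ : 0 < c₁) (hc₂ : 0 < c₂) (hD : 0 < D) (hM : ProjectionHolder M C α)
    (hN : PolynomialEntropy M c₁ c₂ D)
    (P : Measure M) [IsProbabilityMeasure P] (μ : M) {σ : ℝ} (hσ0 : 0 < σ)
    (hσ : frechetFunctional P μ = ENNReal.ofReal (σ ^ 2)) :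
    ∀ᶠ n : ℕ in atTop, ENNReal.ofReal (((c₁ / (c₂ + 2)) ^ (1 / D)) ^ 2 / 8 *
      (1 / (3 * C ^ 2)) ^ (1 / (α + D / 2)) * (1 / (σ ^ 2 * n)) ^ (1 / (α + D / 2))) ≤
        minimaxRisk P μ n := by
  -- Chosen so that `c₁ (1 / (e δ))^D = (c₂ + 2) δ^(-D)`: the logarithm must absorb `c₂ δ^(-D)` from
  -- `N(δ)`, `δ^(-D)` from the second moment, and `log 4 ≤ δ^(-D)`.
  set e : ℝ := (c₁ / (c₂ + 2)) ^ (1 / D) with he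
  have he0 : 0 < e := by positivity
  have heD : (1 / e) ^ D = (c₂ + 2) / c₁ := by
    rw [one_div, Real.inv_rpow he0.le, he, ← Real.rpow_mul (by positivity),
      one_div_mul_cancel hD.ne', Real.rpow_one, inv_div]
  set η : ℝ≥0 := e.toNNReal with hηdef
  have hη : (η : ℝ) = e := Real.coe_toNNReal _ he0.le
  have hη0 : 0 < η := Real.toNNReal_pos.2 he0
  have hsmall : ∀ᶠ δ : ℝ≥0 in 𝓝[>] 0, (δ : ℝ) ^ D < 1 / 2 := by
    have hc : Continuous fun δ : ℝ≥0 => (δ : ℝ) ^ D :=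
      (Real.continuous_rpow_const hD.le).comp NNReal.continuous_coe
    have := hc.tendsto 0
    rw [NNReal.coe_zero, Real.zero_rpow hD.ne'] at this
    exact (this.mono_left nhdsWithin_le_nhds).eventually (gt_mem_nhds (by norm_num))
  -- `A` and `κ` solve `3 C² δ^(2α) σ² n = δ^(-D)`, balancing information against local entropy.
  have key := eventually_le_minimaxRisk hα hC.le hM P μ hσ (A := 1 / (3 * C ^ 2 * σ ^ 2))
    (κ := 1 / (2 * α + D)) (η := η) (by positivity) (by positivity) hη0 (by
      filter_upwards [hN, (tendsto_mul_nhdsGT_zero hη0).eventually hN, hsmall,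
        self_mem_nhdsWithin] with δ h1 h2 hδs hδ
      refine ⟨h1.1, fun n hn hδn => ?_⟩
      have hδ0 : (0 : ℝ) < δ := hδ
      have hn' : (0 : ℝ) < n := by exact_mod_cast hn
      have hδD : 0 < (δ : ℝ) ^ D := by positivity
      have hinv : (1 / (δ : ℝ)) ^ D = 1 / (δ : ℝ) ^ D := by
        rw [one_div, Real.inv_rpow hδ0.le, one_div]
      have hexp : 3 * (C * (δ : ℝ) ^ α) ^ 2 * σ ^ 2 * n = (1 / (δ : ℝ)) ^ D := by
        have h3 : ((δ : ℝ) ^ α) ^ 2 * (δ : ℝ) ^ D = 1 / (3 * C ^ 2 * σ ^ 2) / n := by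
          rw [← Real.rpow_mul_natCast hδ0.le, ← Real.rpow_add hδ0, hδn,
            ← Real.rpow_mul (by positivity)]
          have : 1 / (2 * α + D) * (α * ((2 : ℕ) : ℝ) + D) = 1 := by push_cast; field_simp
          rw [this, Real.rpow_one]
        rw [hinv, eq_div_iff hδD.ne']
        calc 3 * (C * (δ : ℝ) ^ α) ^ 2 * σ ^ 2 * n * (δ : ℝ) ^ D
            = 3 * C ^ 2 * σ ^ 2 * n * (((δ : ℝ) ^ α) ^ 2 * (δ : ℝ) ^ D) := by ring
          _ = 1 := by rw [h3]; field_simp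
      have hbig : Real.log 4 ≤ (1 / (δ : ℝ)) ^ D := by
        have h4 : Real.log 4 = 2 * Real.log 2 := by
          rw [show (4 : ℝ) = 2 ^ 2 by norm_num, Real.log_pow]; norm_num
        have h5 : 2 ≤ 1 / (δ : ℝ) ^ D := by rw [le_div_iff₀ hδD]; linarith
        rw [h4, hinv]
        linarith [Real.log_two_lt_d9]
      have hlow := h2.2.1
      rw [NNReal.coe_mul, hη, ← one_div_mul_one_div, Real.mul_rpow (by positivity) (by positivity),
        heD, ← mul_assoc, mul_div_cancel₀ _ hc₁.ne'] at hlow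
      have hpos : 0 < (1 / (δ : ℝ)) ^ D := by positivity
      have hNε : (0 : ℝ) < (Metric.coveringNumber (η * δ) (Set.univ : Set M)).toNat := by
        rcases Nat.eq_zero_or_pos (Metric.coveringNumber (η * δ) (Set.univ : Set M)).toNat
          with h0 | h0
        -- As `Real.log 0 = 0`, the positive lower bound on the logarithm excludes a zero count.
        · rw [h0, Nat.cast_zero, Real.log_zero] at hlow
          have : 0 < (c₂ + 2) * (1 / (δ : ℝ)) ^ D := by positivity
          linarith
        · exact_mod_cast h0
      rw [hexp]
      rcases Nat.eq_zero_or_pos (Metric.coveringNumber δ (Set.univ : Set M)).toNat with h0 | h0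
      · rw [h0, Nat.cast_zero, mul_zero]
        exact hNε.le
      · have h0' : (0 : ℝ) < (Metric.coveringNumber δ (Set.univ : Set M)).toNat := by
          exact_mod_cast h0
        rw [← Real.log_le_log_iff (by positivity) hNε,
          Real.log_mul (by positivity) h0'.ne', Real.log_mul (by norm_num) (Real.exp_pos _).ne',
          Real.log_exp]
        linarith [h1.2.2])
  filter_upwards [key] with n hn
  refine le_trans (le_of_eq ?_) hn
  congr 1
  have hA : 1 / (3 * C ^ 2 * σ ^ 2) / (n : ℝ) = 1 / (3 * C ^ 2) * (1 / (σ ^ 2 * n)) := by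
    simp only [div_eq_mul_inv, mul_inv]; ring
  clear_value e
  rw [hη, mul_pow, ← Real.rpow_mul_natCast (by positivity)]
  have : 1 / (2 * α + D) * ((2 : ℕ) : ℝ) = 1 / (α + D / 2) := by push_cast; field_simp
  rw [this, hA, Real.mul_rpow (by positivity) (by positivity)]
  ring

end Asymptotics

end MetricRegression

theorem mainTheorem5 (C_U α_U c₁ c₂ : ℝ) (hC_U : 0 < C_U) (hα_pos : 0 < α_U) (hα_le : α_U ≤ 1)
    (hc₁ : 0 < c₁) (hc₂ : 0 < c₂) :
    (∃ c : ℝ, 0 < c ∧ ∀ D : ℝ, 0 < D →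
      ∀ (M : Type*) [MetricSpace M] [CompleteSpace M] [MeasurableSpace M] [BorelSpace M],
        MetricRegression.UniquelyGeodesic M → MetricRegression.ProjectionHolder M C_U α_U →
        MetricRegression.LogPolynomialEntropy M c₁ c₂ D →
        ∀ (P : Measure M) [IsProbabilityMeasure P] (μ : M),
          MetricRegression.IsFrechetMean P μ →
          ∀ σ : ℝ, 0 < σ → MetricRegression.frechetFunctional P μ = ENNReal.ofReal (σ ^ 2) →
            ∀ᶠ n : ℕ in atTop,
              ENNReal.ofReal (c * (D / (σ ^ 2 * n)) ^ (1 / α_U)) ≤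
                MetricRegression.minimaxRisk P μ n) ∧
    (∀ D : ℝ, 0 < D → ∃ c : ℝ, 0 < c ∧
      ∀ (M : Type*) [MetricSpace M] [CompleteSpace M] [MeasurableSpace M] [BorelSpace M],
        MetricRegression.UniquelyGeodesic M → MetricRegression.ProjectionHolder M C_U α_U →
        MetricRegression.PolynomialEntropy M c₁ c₂ D →
        ∀ (P : Measure M) [IsProbabilityMeasure P] (μ : M),
          MetricRegression.IsFrechetMean P μ →
          ∀ σ : ℝ, 0 < σ → MetricRegression.frechetFunctional P μ = ENNReal.ofReal (σ ^ 2) →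
            ∀ᶠ n : ℕ in atTop,
              ENNReal.ofReal (c * (1 / (σ ^ 2 * n)) ^ (1 / (α_U + D / 2))) ≤
                MetricRegression.minimaxRisk P μ n) := by
  -- Both constants are `η² / 8` times the part of `δ²` free of `n`, `σ` and, in (a), `D`.
  refine ⟨⟨(c₁ / (4 * Real.exp 1 * c₂)) ^ 2 / 8 * (1 / (3 * C_U ^ 2)) ^ (1 / α_U),
      by positivity, ?_⟩,
    fun D hD => ⟨((c₁ / (c₂ + 2)) ^ (1 / D)) ^ 2 / 8 * (1 / (3 * C_U ^ 2)) ^ (1 / (α_U + D / 2)),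
      by positivity, ?_⟩⟩
  · intro D _ M _ _ _ _ hG hM hN P _ μ _ σ hσ0 hσ
    exact MetricRegression.eventually_le_minimaxRisk_of_logPolynomialEntropy hα_pos hC_U hc₁ hc₂
      hM hG hN P μ hσ0 hσ
  · intro M _ _ _ _ _ hM hN P _ μ _ σ hσ0 hσ
    exact MetricRegression.eventually_le_minimaxRisk_of_polynomialEntropy hα_pos hC_U hc₁ hc₂ hD
      hM hN P μ hσ0 hσ
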